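/- All graphs are finite, simple and undirected. For a graph $G$ and $S\subseteq V(G)$ let $N(S)$ be the set of vertices having a neighbour in $S$ and let $N[S]=S\cup N(S)$. An independent set $S$ of $G$ is a critical independent set if $|S|-|N(S)|$ is largest possible among all independent sets of $G$. Let $\mathrm{diadem}(G)$ be the union of all critical independent sets of $G$, and $\mathrm{nucleus}(G)$ the intersection of all critical independent sets of maximum cardinality. Let $D(G)$ be the set of vertices missed by some maximum matching of $G$, $A(G)$ the set of vertices outside $D(G)$ that are adjacent to a vertex of $D(G)$, and $C(G)=V(G)\setminus(D(G)\cup A(G))$. Let $Y$ be the set of vertices of the nontrivial components of $G[D(G)]$, that is, $Y=D(G)\setminus X$ where $X$ is the set of isolated vertices of $G[D(G)]$. A graph is almost bipartite if it has exactly one odd cycle, and König–Egerváry if the maximum size of an independent set plus the maximum size of a matching equals the number of vertices. For a matching $M$, an $M$-blossom is an odd cycle of length $2k+1$ with $k$ edges in $M$; its base is the vertex of the cycle that lies on no edge of the cycle in $M$. An $M$-flower consists of an $M$-blossom and an $M$-alternating path of even length (possibly zero) from its base to a vertex not saturated by $M$, such that the base is the only common vertex of the path and the blossom. For an odd cycle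 $Q$ of $G$, $R(Q)$ is the set of all vertices that belong to some $M$-flower with blossom $Q$ for some maximum matching $M$ of $G$. A graph $G$ is a BAB-graph if, for some $k\ge 0$, it arises from the disjoint union of a (possibly empty) bipartite graph $B$ and almost bipartite non-König–Egerváry graphs $G_1,\dots,G_k$, where $R(Q_i)=V(G_i)$ for the unique odd cycle $Q_i$ of $G_i$, by adding edges between vertices of different graphs among $B,G_1,\dots,G_k$ such that every vertex of $B$ incident with an added edge lies in $A(B)\cup C(B)$, and every vertex of $G_i$ incident with an added edge lies in $A(G_i)$, for $i=1,\dots,k$. **Theorem.** Let $G$ be a BAB-graph. Then $$N[\mathrm{diadem}(G)]\cup Y=V(G)\quad\text{and}\quad N[\mathrm{diadem}(G)]\cap Y=\emptyset .$$ Moreover, the sets $\mathrm{nucleus}(G)$, $D(G)\setminus\mathrm{nucleus}(G)$, $A(G)$ and $C(G)$ are pairwise disjoint and their union is $V(G)$ (some of them may be empty). -/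

import Mathlib

namespace BAB

open SimpleGraph

variable {V : Type*}

/-- The set `N(S)` of all vertices that have a neighbour in `S`. -/
def nbhd (G : SimpleGraph V) (S : Set V) : Set V := {v | ∃ u ∈ S, G.Adj u v}

/-- The closed neighbourhood `N[S] = S ∪ N(S)`. -/
def closedNbhd (G : SimpleGraph V) (S : Set V) : Set V := S ∪ nbhd G S

/-- The vertices of `S` with a neighbour outside `S`. -/
def boundary (G : SimpleGraph V) (S : Set V) : Set V := {v | v ∈ S ∧ ∃ w, w ∉ S ∧ G.Adj v w}

/-! ### Critical independent sets -/

/-- The difference `|S| - |N(S)|`. -/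
noncomputable def diff (G : SimpleGraph V) (S : Set V) : ℤ := (S.ncard : ℤ) - ((nbhd G S).ncard : ℤ)

/-- `S` is independent and has the largest difference among all independent sets. -/
def IsCriticalIndep (G : SimpleGraph V) (S : Set V) : Prop :=
  G.IsIndepSet S ∧ ∀ T : Set V, G.IsIndepSet T → diff G T ≤ diff G S

/-- A critical independent set of maximum cardinality. -/
def IsMaximumCriticalIndep (G : SimpleGraph V) (S : Set V) : Prop :=
  IsCriticalIndep G S ∧ ∀ T : Set V, IsCriticalIndep G T → T.ncard ≤ S.ncard

/-- The intersection of all maximum critical independent sets. -/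
def nucleus (G : SimpleGraph V) : Set V := {v | ∀ S : Set V, IsMaximumCriticalIndep G S → v ∈ S}

/-- The union of all critical independent sets. -/
def diadem (G : SimpleGraph V) : Set V := {v | ∃ S : Set V, IsCriticalIndep G S ∧ v ∈ S}

/-! ### Maximum matchings and the Gallai–Edmonds sets -/

/-- `M` is a matching with the largest number of edges. -/
def IsMaximumMatching (G : SimpleGraph V) (M : G.Subgraph) : Prop :=
  M.IsMatching ∧ ∀ M' : G.Subgraph, M'.IsMatching → M'.edgeSet.ncard ≤ M.edgeSet.ncard

/-- The matching number `μ(G)`. -/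
noncomputable def matchingNumber (G : SimpleGraph V) : ℕ :=
  sSup {n | ∃ M : G.Subgraph, M.IsMatching ∧ M.edgeSet.ncard = n}

/-- `α(G) + μ(G) = |V(G)|`. -/
def IsKonigEgervary (G : SimpleGraph V) : Prop := G.indepNum + matchingNumber G = Nat.card V

/-- The vertices missed by some maximum matching. -/
def geD (G : SimpleGraph V) : Set V := {v | ∃ M : G.Subgraph, IsMaximumMatching G M ∧ v ∉ M.verts}

/-- The vertices outside `D(G)` that are adjacent to a vertex of `D(G)`. -/
def geA (G : SimpleGraph V) : Set V := {v | v ∉ geD G ∧ ∃ u ∈ geD G, G.Adj u v}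

/-- The remaining vertices. -/
def geC (G : SimpleGraph V) : Set V := (geD G ∪ geA G)ᶜ

/-- The isolated vertices of `G[D(G)]`. -/
def setX (G : SimpleGraph V) : Set V := {v | v ∈ geD G ∧ ∀ u ∈ geD G, ¬ G.Adj v u}

/-- The vertices of the nontrivial components of `G[D(G)]`. -/
def setY (G : SimpleGraph V) : Set V := geD G \ setX G

/-! ### Odd cycles and flowers -/

/-- `C` is an odd cycle of `G`, as a subgraph. -/
def IsOddCycle (G : SimpleGraph V) (C : G.Subgraph) : Prop :=
  ∃ (u : V) (p : G.Walk u u), p.IsCycle ∧ Odd p.length ∧ p.toSubgraph = C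

/-- `G` has exactly one odd cycle. -/
def IsAlmostBipartite (G : SimpleGraph V) : Prop := ∃! C : G.Subgraph, IsOddCycle G C

/-- `C` is an odd cycle of length `2k + 1` with `k` edges in `M`. -/
def IsBlossom (G : SimpleGraph V) (M C : G.Subgraph) : Prop :=
  IsOddCycle G C ∧ C.edgeSet.ncard = 2 * (C.edgeSet ∩ M.edgeSet).ncard + 1

/-- `b` is the vertex of `C` that lies on no edge of `C` in `M`. -/
def IsBase (G : SimpleGraph V) (M C : G.Subgraph) (b : V) : Prop :=
  b ∈ C.verts ∧ ∀ w, ¬ (C.Adj b w ∧ M.Adj b w)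

/-- Of any two consecutive edges of the walk, exactly one belongs to `M`. -/
def IsAlternatingWalk (G : SimpleGraph V) (M : G.Subgraph) {u v : V} (p : G.Walk u v) : Prop :=
  p.edges.IsChain fun e f => Xor (e ∈ M.edgeSet) (f ∈ M.edgeSet)

/-- The `M`-blossom `C` with base `b` and the `M`-stem `p`, which leads from `b` to the root `r`,
form an `M`-flower. -/
def IsFlower (G : SimpleGraph V) (M C : G.Subgraph) {b r : V} (p : G.Walk b r) : Prop :=
  IsBlossom G M C ∧ IsBase G M C b ∧ p.IsPath ∧ Even p.length ∧ IsAlternatingWalk G M p ∧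
    r ∉ M.verts ∧ ∀ v ∈ p.support, v ∈ C.verts → v = b

/-- The reach set `R(C)`: all vertices of `M`-flowers with blossom `C`, for all maximum
matchings `M`. -/
def reachSet (G : SimpleGraph V) (C : G.Subgraph) : Set V :=
  {v | ∃ M : G.Subgraph, IsMaximumMatching G M ∧ ∃ (b r : V) (p : G.Walk b r),
    IsFlower G M C p ∧ (v ∈ C.verts ∨ v ∈ p.support)}

/-! ### BAB-graphs -/

/-- The vertex sets `B` and `P 1, …, P k` exhibit `G` as a BAB-graph: they partition the vertices;
`G[B]` is bipartite; each `G[P i]` is almost bipartite, not König–Egerváry, and equal to the reach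
set of its odd cycle; vertices of `B` with neighbours outside `B` lie in `A(G[B]) ∪ C(G[B])`, and
vertices of `P i` with neighbours outside `P i` lie in `A(G[P i])`. -/
structure IsBABDecomposition (G : SimpleGraph V) {k : ℕ} (B : Set V) (P : Fin k → Set V) :
    Prop where
  cover : B ∪ (⋃ i, P i) = Set.univ
  disjoint_base : ∀ i, Disjoint B (P i)
  disjoint_parts : ∀ i j, i ≠ j → Disjoint (P i) (P j)
  bipartite : (G.induce B).IsBipartite
  almostBipartite : ∀ i, IsAlmostBipartite (G.induce (P i))
  not_konigEgervary : ∀ i, ¬ IsKonigEgervary (G.induce (P i))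
  reach : ∀ i, ∀ C : (G.induce (P i)).Subgraph, IsOddCycle (G.induce (P i)) C →
    reachSet (G.induce (P i)) C = Set.univ
  boundary_base : boundary G B ⊆ Subtype.val '' (geA (G.induce B) ∪ geC (G.induce B))
  boundary_parts : ∀ i, boundary G (P i) ⊆ Subtype.val '' geA (G.induce (P i))

/-- `G` is a BAB-graph. -/
def IsBABGraph (G : SimpleGraph V) : Prop :=
  ∃ (k : ℕ) (B : Set V) (P : Fin k → Set V), IsBABDecomposition G B P

end BAB

/-!
Encode matchings as involutions. The heart of the matter is that every independent set `S` has a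
maximum matching adapted to it: one that matches `A` into `X` and misses in `Y` only vertices
outside `S`, among them one of `N(S)` if `N(S)` meets `Y`. Counting along this matching gives
`|S| - |N(S)| ≤ |X| - |A|`, and equality forces both `S` and `N(S)` to avoid `Y`. Hence `X` together
with either colour class of the bipartite graph `G[C]` is a maximum critical independent set, so
`nucleus(G) ⊆ X` and the closed neighbourhood of the diadem is the complement of `Y`.

In a bipartite graph `Y` is empty and every maximum matching is adapted. If the odd cycle of an
almost bipartite graph is the blossom of a flower, then switching along the stem and rotating around
the cycle yields a maximum matching that misses any prescribed vertex of the cycle and matches the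
rest of the cycle within itself. So the cycle lies in `D`, and since it is the only odd cycle, its
edges are the only edges of `G[D]`, i.e. `Y` is its vertex set; an adapted matching is obtained by
missing a suitable vertex of the cycle. If moreover the flowers cover the graph, then `C` is empty.

Since no added edge of a BAB-graph meets the set `D` of a part, maximum matchings of the parts glue
to a maximum matching of `G`, and `D`, `A`, `C`, `X` and `Y` are the unions of those of the parts.
-/

namespace BAB

open SimpleGraph Function

section Pairing

variable {V : Type*} {G : SimpleGraph V} {m m' : V → V}

/-- A matching of `G`, encoded as the involution that exchanges the ends of its edges and fixes the
unsaturated vertices. -/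
structure IsPairing (G : SimpleGraph V) (m : V → V) : Prop where
  invol : Involutive m
  adj : ∀ v, m v ≠ v → G.Adj v (m v)

/-- A pairing with the fewest fixed points, which encodes a maximum matching. -/
def IsMaxPairing (G : SimpleGraph V) (m : V → V) : Prop :=
  IsPairing G m ∧ ∀ m', IsPairing G m' → (fixedPoints m).ncard ≤ (fixedPoints m').ncard

theorem isPairing_id (G : SimpleGraph V) : IsPairing G id :=
  ⟨fun _ => rfl, fun _ h => (h rfl).elim⟩

theorem IsPairing.mono {G' : SimpleGraph V} (hm : IsPairing G m) (h : G ≤ G') : IsPairing G' m :=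
  ⟨hm.invol, fun v hv => h (hm.adj v hv)⟩

theorem IsPairing.apply_notMem_fixedPoints (hm : IsPairing G m) {v : V} (hv : v ∉ fixedPoints m) :
    m v ∉ fixedPoints m :=
  fun h => hv (hm.invol.injective h)

theorem exists_isMaxPairing [Finite V] (G : SimpleGraph V) : ∃ m, IsMaxPairing G m := by
  obtain ⟨m, hm, h⟩ := Set.exists_min_image {m | IsPairing G m} (fun m => (fixedPoints m).ncard)
    (Set.toFinite _) ⟨id, isPairing_id G⟩
  exact ⟨m, hm, h⟩

theorem IsMaxPairing.ncard_eq (hm : IsMaxPairing G m) (hm' : IsMaxPairing G m') :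
    (fixedPoints m).ncard = (fixedPoints m').ncard :=
  le_antisymm (hm.2 _ hm'.1) (hm'.2 _ hm.1)

theorem IsMaxPairing.of_ncard_le (hm : IsMaxPairing G m) (hm' : IsPairing G m')
    (h : (fixedPoints m').ncard ≤ (fixedPoints m).ncard) : IsMaxPairing G m' :=
  ⟨hm', fun _ h' => h.trans (hm.2 _ h')⟩

theorem IsMaxPairing.fixedPoints_eq_of_subset [Finite V] (hm : IsMaxPairing G m)
    (hm' : IsMaxPairing G m') (h : fixedPoints m ⊆ fixedPoints m') :
    fixedPoints m = fixedPoints m' :=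
  Set.eq_of_subset_of_ncard_le h (hm'.ncard_eq hm).le

end Pairing

section Rematch

variable {V : Type*} {G : SimpleGraph V} {m m' : V → V} {r x v : V}

open Classical in
/-- For an unsaturated vertex `r`, the pairing `m` with the edge at `x` replaced by `r x`. -/
noncomputable def rematch (m : V → V) (r x v : V) : V :=
  if v = r then x else if v = x then r else if v = m x then m x else m v

@[simp]
theorem rematch_left : rematch m r x r = x := if_pos rfl

@[simp]
theorem rematch_right : rematch m r x x = r := by
  unfold rematch
  grind

theorem rematch_apply_of_ne (hr : v ≠ r) (hx : v ≠ x) (hmx : v ≠ m x) :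
    rematch m r x v = m v := by
  simp only [rematch, if_neg hr, if_neg hx, if_neg hmx]

theorem fixedPoints_rematch_subset (hr : m r = r) :
    fixedPoints (rematch m r x) ⊆ insert (m x) (fixedPoints m \ {r}) := by
  intro v hv
  simp only [mem_fixedPoints, IsFixedPt, Set.mem_insert_iff, Set.mem_sdiff,
    Set.mem_singleton_iff] at hv ⊢
  unfold rematch at hv
  grind

theorem IsPairing.rematch_apply (hm : IsPairing G m) (hr : m r = r) (hrx : r ≠ x)
    (hx : m x ≠ x) : rematch m r x (m x) = m x := by
  have : m x ≠ r := fun h => hrx (by rw [← hm.invol x, h, hr])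
  simp only [rematch, if_neg this, if_neg hx, if_pos]

theorem IsPairing.rematch (hm : IsPairing G m) (hr : m r = r) (h : G.Adj r x) :
    IsPairing G (rematch m r x) := by
  have := hm.invol
  refine ⟨fun v => ?_, fun v hv => ?_⟩
  · unfold BAB.rematch
    grind [Involutive]
  · have := hm.adj v
    have := h.symm
    unfold BAB.rematch at hv ⊢
    grind

theorem IsPairing.setOf_rematch_ne_ssubset (hm : IsPairing G m) (hm' : IsPairing G m')
    (hr : m r = r) (hr' : m' r ≠ r) :
    {v | BAB.rematch m r (m' r) v ≠ m' v} ⊂ {v | m v ≠ m' v} := by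
  have := hm.invol
  have := hm'.invol
  refine (Set.ssubset_iff_of_subset fun v hv => ?_).2 ⟨r, fun h => hr' ?_, fun h => h ?_⟩
  · simp only [Set.mem_ofPred_eq, BAB.rematch] at hv ⊢
    grind [Involutive]
  · rw [← h, hr]
  · exact rematch_left

variable [Finite V]

theorem IsMaxPairing.rematch (hm : IsMaxPairing G m) (hr : m r = r) (h : G.Adj r x) :
    IsMaxPairing G (rematch m r x) := by
  refine hm.of_ncard_le (hm.1.rematch hr h) ?_
  calc _ ≤ _ := Set.ncard_le_ncard (fixedPoints_rematch_subset hr)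
    _ ≤ (fixedPoints m \ {r}).ncard + 1 := Set.ncard_insert_le _ _
    _ = _ := Set.ncard_sdiff_singleton_add_one hr

theorem IsMaxPairing.apply_ne_of_adj (hm : IsMaxPairing G m) (hr : m r = r) (h : G.Adj r x) :
    m x ≠ x := by
  intro hx
  have hsub : fixedPoints (BAB.rematch m r x) ⊆ fixedPoints m \ {r} := by
    refine (fixedPoints_rematch_subset hr).trans (Set.insert_subset ?_ subset_rfl)
    exact ⟨congrArg m hx, by rw [hx]; exact h.ne'⟩
  exact (hm.2 _ (hm.1.rematch hr h)).not_gt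
    ((Set.ncard_le_ncard hsub).trans_lt (Set.ncard_sdiff_singleton_lt_of_mem hr))

/-- Take `m` as close to `m'` as possible. -/
theorem exists_isMaxPairing_forall_not_rematch (hm' : IsPairing G m') {p : (V → V) → Prop}
    (hp : ∃ m, IsMaxPairing G m ∧ p m) :
    ∃ m, IsMaxPairing G m ∧ p m ∧ ∀ r, m r = r → m' r ≠ r → ¬ p (BAB.rematch m r (m' r)) := by
  obtain ⟨m, ⟨hm, hpm⟩, hmin⟩ := Set.exists_min_image {m | IsMaxPairing G m ∧ p m}
    (fun m => {v | m v ≠ m' v}.ncard) (Set.toFinite _) hp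
  refine ⟨m, hm, hpm, fun r hr hr' hpr => ?_⟩
  exact (hmin _ ⟨hm.rematch hr (hm'.adj r hr'), hpr⟩).not_gt
    (Set.ncard_lt_ncard (hm.1.setOf_rematch_ne_ssubset hm' hr hr'))

theorem exists_isMaxPairing_fixedPoints_subset (hm' : IsPairing G m') :
    ∃ m, IsMaxPairing G m ∧ fixedPoints m ⊆ fixedPoints m' := by
  obtain ⟨m₀, hm₀⟩ := exists_isMaxPairing G
  obtain ⟨m, hm, -, h⟩ := exists_isMaxPairing_forall_not_rematch hm' (p := fun _ => True)
    ⟨m₀, hm₀, trivial⟩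
  exact ⟨m, hm, fun r hr => by_contra fun hr' => h r hr hr' trivial⟩

end Rematch

section Matching

variable {V : Type*} {G : SimpleGraph V} {m : V → V}

/-- The matching encoded by a pairing. -/
def IsPairing.toSubgraph (hm : IsPairing G m) : G.Subgraph where
  verts := (fixedPoints m)ᶜ
  Adj v w := m v = w ∧ m v ≠ v
  adj_sub := by
    rintro v w ⟨rfl, h⟩
    exact hm.adj v h
  edge_vert := fun h => h.2
  symm := ⟨by
    rintro v w ⟨rfl, h⟩
    exact ⟨hm.invol v, by rw [hm.invol]; exact h.symm⟩⟩

theorem IsPairing.isMatching_toSubgraph (hm : IsPairing G m) : hm.toSubgraph.IsMatching :=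
  fun v hv => ⟨m v, ⟨rfl, hv⟩, fun _ h => h.1.symm⟩

theorem exists_isPairing_toSubgraph_eq {M : G.Subgraph} (hM : M.IsMatching) :
    ∃ (m : V → V) (hm : IsPairing G m), hm.toSubgraph = M := by
  classical
  choose g hg using fun v (h : v ∈ M.verts) => (hM h).exists
  let m : V → V := fun v => if h : v ∈ M.verts then g v h else v
  have apply_of_mem : ∀ v ∈ M.verts, M.Adj v (m v) := fun v hv => by
    simp only [m, hv, dif_pos]
    exact hg v hv
  have apply_of_notMem : ∀ v, v ∉ M.verts → m v = v := fun v hv => dif_neg hv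
  have hm : IsPairing G m := by
    refine ⟨fun v => ?_, fun v hv => ?_⟩ <;> by_cases h : v ∈ M.verts
    · have h' := apply_of_mem v h
      exact hM.eq_of_adj_left (apply_of_mem _ h'.symm.fst_mem) h'.symm
    · rw [apply_of_notMem v h, apply_of_notMem v h]
    · exact (apply_of_mem v h).adj_sub
    · exact (hv (apply_of_notMem v h)).elim
  have apply_ne_iff : ∀ v, m v ≠ v ↔ v ∈ M.verts := fun v =>
    ⟨not_imp_comm.1 (apply_of_notMem v), fun h => (apply_of_mem v h).ne.symm⟩
  refine ⟨m, hm, Subgraph.ext (Set.ext apply_ne_iff) ?_⟩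
  ext v w
  refine ⟨?_, fun h => ?_⟩
  · rintro ⟨rfl, h⟩
    exact apply_of_mem v ((apply_ne_iff v).1 h)
  · exact ⟨hM.eq_of_adj_left (apply_of_mem v h.fst_mem) h, (apply_ne_iff v).2 h.fst_mem⟩

theorem ncard_verts_mul_of_ncard_neighborSet [Finite V] (M : G.Subgraph) (d : ℕ)
    (h : ∀ v ∈ M.verts, (M.neighborSet v).ncard = d) :
    M.verts.ncard * d = 2 * M.edgeSet.ncard := by
  classical
  have := Fintype.ofFinite V
  have hdegree : ∀ v, M.spanningCoe.degree v = if v ∈ M.verts then d else 0 := by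
    intro v
    rw [← SimpleGraph.card_neighborSet_eq_degree, ← Nat.card_eq_fintype_card,
      show M.spanningCoe.neighborSet v = M.neighborSet v from rfl, Nat.card_coe_set_eq]
    split_ifs with hv
    · exact h v hv
    · rw [Set.ncard_eq_zero]
      exact Set.eq_empty_of_forall_notMem fun w hw => hv (M.edge_vert hw)
  have hsum := M.spanningCoe.sum_degrees_eq_twice_card_edges
  simp only [hdegree, Finset.sum_ite, Finset.sum_const_zero, Finset.sum_const, add_zero,
    smul_eq_mul] at hsum
  rw [Set.ncard_eq_toFinset_card', Set.ncard_eq_toFinset_card']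
  convert hsum using 3
  · ext; simp
  · ext e; simp

theorem ncard_verts_of_isMatching [Finite V] {M : G.Subgraph} (hM : M.IsMatching) :
    M.verts.ncard = 2 * M.edgeSet.ncard := by
  rw [← ncard_verts_mul_of_ncard_neighborSet M 1, mul_one]
  intro v hv
  obtain ⟨w, hw, hunique⟩ := hM hv
  exact Set.ncard_eq_one.2 ⟨w, Set.eq_singleton_iff_unique_mem.2 ⟨hw, hunique⟩⟩

theorem IsPairing.ncard_fixedPoints_add [Finite V] (hm : IsPairing G m) :
    (fixedPoints m).ncard + 2 * hm.toSubgraph.edgeSet.ncard = Nat.card V := by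
  rw [← ncard_verts_of_isMatching hm.isMatching_toSubgraph]
  exact Set.ncard_add_ncard_compl _

theorem isMaximumMatching_toSubgraph_iff [Finite V] (hm : IsPairing G m) :
    IsMaximumMatching G hm.toSubgraph ↔ IsMaxPairing G m := by
  have hcard := hm.ncard_fixedPoints_add
  constructor
  · refine fun hmax => ⟨hm, fun m' hm' => ?_⟩
    have := hmax.2 _ hm'.isMatching_toSubgraph
    have := hm'.ncard_fixedPoints_add
    omega
  · refine fun hmax => ⟨hm.isMatching_toSubgraph, fun M' hM' => ?_⟩
    obtain ⟨m', hm', rfl⟩ := exists_isPairing_toSubgraph_eq hM'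
    have := hmax.2 _ hm'
    have := hm'.ncard_fixedPoints_add
    omega

theorem mem_geD_iff [Finite V] {v : V} : v ∈ geD G ↔ ∃ m, IsMaxPairing G m ∧ m v = v := by
  constructor
  · rintro ⟨M, hM, hv⟩
    obtain ⟨m, hm, rfl⟩ := exists_isPairing_toSubgraph_eq hM.1
    exact ⟨m, (isMaximumMatching_toSubgraph_iff hm).1 hM, not_not.1 hv⟩
  · rintro ⟨m, hm, hv⟩
    exact ⟨hm.1.toSubgraph, (isMaximumMatching_toSubgraph_iff hm.1).2 hm, not_not.2 hv⟩

theorem IsMaxPairing.mem_geD [Finite V] (hm : IsMaxPairing G m) {v : V} (hv : m v = v) :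
    v ∈ geD G :=
  mem_geD_iff.2 ⟨m, hm, hv⟩

end Matching

section GallaiEdmonds

variable {V : Type*} {G : SimpleGraph V} {m : V → V}

theorem nbhd_setX_subset_geA : nbhd G (setX G) ⊆ geA G := by
  rintro v ⟨u, hu, huv⟩
  exact ⟨fun hv => hu.2 v hv huv, u, hu.1, huv⟩

variable [Finite V]

theorem IsMaxPairing.apply_ne (hm : IsMaxPairing G m) {v : V} (hv : v ∉ geD G) : m v ≠ v :=
  fun h => hv (hm.mem_geD h)

theorem IsMaxPairing.apply_mem_geD_of_adj (hm : IsMaxPairing G m) {r x : V} (hr : m r = r)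
    (h : G.Adj r x) : m x ∈ geD G :=
  (hm.rematch hr h).mem_geD (hm.1.rematch_apply hr h.ne (hm.apply_ne_of_adj hr h))

theorem IsMaxPairing.apply_mem_geD (hm : IsMaxPairing G m) {a : V} (ha : a ∈ geA G) :
    m a ∈ geD G := by
  obtain ⟨haD, d, hd, hda⟩ := ha
  obtain ⟨m', hm', hd'⟩ := mem_geD_iff.1 hd
  by_contra hmaD
  obtain ⟨n, hn, hna, hclosest⟩ := exists_isMaxPairing_forall_not_rematch hm'.1
    (p := fun n => n a = m a) ⟨m, hm, rfl⟩
  have hsub : fixedPoints n ⊆ fixedPoints m' := by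
    intro r hr
    by_contra hr'
    have hadj := hm'.1.adj r hr'
    have hax : a ≠ m' r := by
      intro h
      rw [← hna, h] at hmaD
      exact hmaD (hn.apply_mem_geD_of_adj hr hadj)
    have hanx : a ≠ n (m' r) := by
      intro h
      rw [h] at haD
      exact haD (hn.apply_mem_geD_of_adj hr hadj)
    have har : a ≠ r := fun h => hn.apply_ne haD (h ▸ hr)
    exact hclosest r hr hr' ((rematch_apply_of_ne har hax hanx).trans hna)
  have hnd : d ∈ fixedPoints n := hn.fixedPoints_eq_of_subset hm' hsub ▸ hd'
  exact hmaD (hna ▸ hn.apply_mem_geD_of_adj hnd hda)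

theorem IsMaxPairing.apply_mem_geC (hm : IsMaxPairing G m) {c : V} (hc : c ∈ geC G) :
    m c ∈ geC G := by
  have hcD : c ∉ geD G := fun h => hc (Or.inl h)
  rintro (h | h)
  · exact hc (Or.inr ⟨hcD, m c, h, (hm.1.adj c (hm.apply_ne hcD)).symm⟩)
  · exact hcD (hm.1.invol c ▸ hm.apply_mem_geD h)

end GallaiEdmonds

section Bipartite

variable {V : Type*} [Finite V] {G : SimpleGraph V} {m m' : V → V}

theorem IsPairing.ncard_fixedPoints_add_two_mul_ncard_colorClass (hm : IsPairing G m)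
    (c : G.Coloring Bool) (b : Bool) :
    (fixedPoints m).ncard + 2 * (c.colorClass b).ncard =
      Nat.card V + 2 * (fixedPoints m ∩ c.colorClass b).ncard := by
  set R := c.colorClass b
  have mem_R : ∀ v, v ∈ R ↔ c v = b := fun _ => Iff.rfl
  have himage : m '' (R \ fixedPoints m) = Rᶜ \ fixedPoints m := by
    rw [hm.invol.image_eq_preimage_symm]
    ext v
    by_cases hv : v ∈ fixedPoints m
    · simp [hv, show m v = v from hv]
    · have : c v = !c (m v) := Bool.eq_not_of_ne (c.valid (hm.adj v hv))
      have := hm.apply_notMem_fixedPoints hv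
      grind
  have hcard := congrArg Set.ncard himage
  rw [Set.ncard_image_of_injective _ hm.invol.injective] at hcard
  have hR := Set.ncard_inter_add_ncard_sdiff_eq_ncard R (fixedPoints m)
  have hR' := Set.ncard_inter_add_ncard_sdiff_eq_ncard Rᶜ (fixedPoints m)
  have hF := Set.ncard_inter_add_ncard_sdiff_eq_ncard (fixedPoints m) R
  have hV := Set.ncard_add_ncard_compl R
  rw [Set.inter_comm] at hR
  rw [Set.inter_comm, ← Set.sdiff_eq] at hR'
  omega

theorem IsMaxPairing.ncard_fixedPoints_inter_colorClass (hm : IsMaxPairing G m)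
    (hm' : IsMaxPairing G m') (c : G.Coloring Bool) (b : Bool) :
    (fixedPoints m ∩ c.colorClass b).ncard = (fixedPoints m' ∩ c.colorClass b).ncard := by
  have := hm.1.ncard_fixedPoints_add_two_mul_ncard_colorClass c b
  have := hm'.1.ncard_fixedPoints_add_two_mul_ncard_colorClass c b
  have := hm.ncard_eq hm'
  omega

theorem not_adj_of_mem_geD_of_isBipartite (hG : G.IsBipartite) {u v : V} (hu : u ∈ geD G)
    (hv : v ∈ geD G) : ¬ G.Adj u v := by
  intro huv
  obtain ⟨m', hm', hv'⟩ := mem_geD_iff.1 hv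
  obtain ⟨n, hn, hnu, hclosest⟩ := exists_isMaxPairing_forall_not_rematch hm'.1
    (p := fun n => n u = u) (mem_geD_iff.1 hu)
  have hsub : fixedPoints n \ {u} ⊆ fixedPoints m' := by
    rintro r ⟨hr, hru⟩
    by_contra hr'
    have hux : u ≠ m' r := fun h => hn.apply_ne_of_adj hr (h ▸ hm'.1.adj r hr') hnu
    have hunx : u ≠ n (m' r) := fun h => hux (by rw [← hn.1.invol (m' r), ← h, hnu])
    exact hclosest r hr hr' ((rematch_apply_of_ne (Ne.symm hru) hux hunx).trans hnu)
  let c : G.Coloring Bool := Colorable.toColoring hG (by simp)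
  have hssub : fixedPoints n ∩ c.colorClass (c v) ⊂ fixedPoints m' ∩ c.colorClass (c v) := by
    have hu_notMem : u ∉ c.colorClass (c v) := c.valid huv
    refine (Set.ssubset_iff_of_subset ?_).2
      ⟨v, ⟨hv', rfl⟩, fun h => hn.apply_ne_of_adj hnu huv h.1⟩
    exact fun r hr => ⟨hsub ⟨hr.1, fun h => hu_notMem (h ▸ hr.2)⟩, hr.2⟩
  exact (Set.ncard_lt_ncard hssub).ne (hn.ncard_fixedPoints_inter_colorClass hm' c _)

end Bipartite

section Critical

variable {V : Type*} {G : SimpleGraph V} {m : V → V} {S : Set V}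

theorem mem_setY_iff {v : V} : v ∈ setY G ↔ v ∈ geD G ∧ ∃ u ∈ geD G, G.Adj v u := by
  simp only [setY, setX, Set.mem_sdiff, Set.mem_ofPred_eq, not_and, not_forall, not_not]
  grind

theorem geD_sdiff_setY : geD G \ setY G = setX G :=
  sdiff_sdiff_eq_self fun _ h => h.1

theorem isIndepSet_setX : G.IsIndepSet (setX G) :=
  fun _ hu _ hv _ huv => hu.2 _ hv.1 huv

theorem not_adj_of_mem_geD_of_mem_geC {u v : V} (hu : u ∈ geD G) (hv : v ∈ geC G) :
    ¬ G.Adj u v :=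
  fun huv => hv (Or.inr ⟨fun hvD => hv (Or.inl hvD), u, hu, huv⟩)

theorem disjoint_nbhd_of_isIndepSet (hS : G.IsIndepSet S) : Disjoint S (nbhd G S) :=
  Set.disjoint_left.2 fun _ hv ⟨_, hu, huv⟩ => hS hu hv huv.ne huv

/-- A maximum matching that shows `|S| - |N(S)| ≤ |X| - |A|`: it matches `A` into `X`, and of the
nontrivial components of `G[D]` it leaves uncovered only vertices outside `S`, among them one of
`N(S)` if `N(S)` meets these components. -/
structure IsAdapted (G : SimpleGraph V) (S : Set V) (m : V → V) : Prop where
  max : IsMaxPairing G m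
  mapsTo : Set.MapsTo m (geA G) (setX G)
  notMem : ∀ v ∈ setY G, m v = v → v ∉ S
  exists_fixed : (nbhd G S ∩ setY G).Nonempty → ∃ v ∈ nbhd G S ∩ setY G, m v = v

/-- Every independent set has an adapted maximum matching: the property of the parts of a
BAB-graph that passes to the whole graph. -/
def HasAdaptedPairings (G : SimpleGraph V) : Prop :=
  ∀ S, G.IsIndepSet S → ∃ m, IsAdapted G S m

theorem HasAdaptedPairings.geA_eq (h : HasAdaptedPairings G) : geA G = nbhd G (setX G) := by
  refine Set.Subset.antisymm (fun a ha => ?_) nbhd_setX_subset_geA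
  obtain ⟨m, hm⟩ := h ∅ (Set.pairwise_empty _)
  have hma := hm.mapsTo ha
  exact ⟨m a, hma, (hm.max.1.adj a fun h => ha.1 (h ▸ hma.1)).symm⟩

variable [Finite V]

theorem IsPairing.ncard_sdiff_fixedPoints_le (hm : IsPairing G m) (S : Set V) :
    (S \ fixedPoints m).ncard ≤ (nbhd G S \ fixedPoints m).ncard := by
  refine Set.ncard_le_ncard_of_injOn m (fun v hv => ⟨⟨v, hv.1, hm.adj v hv.2⟩, ?_⟩)
    hm.invol.injective.injOn
  exact hm.apply_notMem_fixedPoints hv.2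

theorem IsAdapted.ncard_inter_fixedPoints_add_le (hm : IsAdapted G S m) :
    (S ∩ fixedPoints m).ncard + (geA G).ncard ≤ (setX G).ncard := by
  have hinj := hm.max.1.invol.injective
  have hdisj : Disjoint (S ∩ fixedPoints m) (m '' geA G) := by
    refine Set.disjoint_left.2 fun v hv ⟨a, ha, hav⟩ => ?_
    have : a = v := hinj (hav.trans hv.2.symm)
    exact ha.1 (this ▸ hm.max.mem_geD hv.2)
  rw [← Set.ncard_image_of_injective (geA G) hinj, ← Set.ncard_union_eq hdisj]
  refine Set.ncard_le_ncard (Set.union_subset (fun v hv => ?_) hm.mapsTo.image_subset)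
  by_contra hvX
  exact hm.notMem v ⟨hm.max.mem_geD hv.2, hvX⟩ hv.2 hv.1

theorem IsAdapted.ncard_add_ncard_geA_le (hm : IsAdapted G S m) :
    S.ncard + (geA G).ncard + (nbhd G S ∩ fixedPoints m).ncard ≤
      (nbhd G S).ncard + (setX G).ncard := by
  have := hm.max.1.ncard_sdiff_fixedPoints_le S
  have := hm.ncard_inter_fixedPoints_add_le
  have := Set.ncard_inter_add_ncard_sdiff_eq_ncard S (fixedPoints m)
  have := Set.ncard_inter_add_ncard_sdiff_eq_ncard (nbhd G S) (fixedPoints m)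
  omega

theorem HasAdaptedPairings.diff_le (h : HasAdaptedPairings G) (hS : G.IsIndepSet S) :
    diff G S ≤ diff G (setX G) := by
  obtain ⟨m, hm⟩ := h S hS
  have := hm.ncard_add_ncard_geA_le
  rw [diff, diff, ← h.geA_eq]
  omega

theorem HasAdaptedPairings.isCriticalIndep_iff (h : HasAdaptedPairings G) :
    IsCriticalIndep G S ↔ G.IsIndepSet S ∧ diff G (setX G) ≤ diff G S :=
  ⟨fun hS => ⟨hS.1, hS.2 _ isIndepSet_setX⟩,
    fun hS => ⟨hS.1, fun _ hT => (h.diff_le hT).trans hS.2⟩⟩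

theorem HasAdaptedPairings.disjoint_nbhd_setY (h : HasAdaptedPairings G)
    (hS : IsCriticalIndep G S) : Disjoint (nbhd G S) (setY G) := by
  obtain ⟨hindep, hdiff⟩ := h.isCriticalIndep_iff.1 hS
  obtain ⟨m, hm⟩ := h S hindep
  by_contra hmeet
  obtain ⟨v, hv, hvm⟩ := hm.exists_fixed (Set.not_disjoint_iff_nonempty_inter.1 hmeet)
  have hpos : 0 < (nbhd G S ∩ fixedPoints m).ncard :=
    (Set.ncard_pos (Set.toFinite _)).2 ⟨v, hv.1, hvm⟩
  have := hm.ncard_add_ncard_geA_le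
  rw [diff, diff, ← h.geA_eq] at hdiff
  omega

theorem HasAdaptedPairings.disjoint_setY (h : HasAdaptedPairings G) (hS : IsCriticalIndep G S) :
    Disjoint S (setY G) := by
  refine Set.disjoint_left.2 fun v hvS hvY => ?_
  obtain ⟨hvD, u, hu, hvu⟩ := mem_setY_iff.1 hvY
  exact Set.disjoint_left.1 (h.disjoint_nbhd_setY hS) ⟨v, hvS, hvu⟩
    (mem_setY_iff.2 ⟨hu, v, hvD, hvu.symm⟩)

theorem IsMaxPairing.ncard_colorClass_le (hm : IsMaxPairing G m)
    (c : (G.induce (geC G)).Coloring Bool) (b : Bool) :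
    (c.colorClass b).ncard ≤ (c.colorClass !b).ncard := by
  let f : geC G → geC G := fun v => ⟨m v, hm.apply_mem_geC v.2⟩
  refine Set.ncard_le_ncard_of_injOn f (fun v (hv : c v = b) => ?_) fun u _ v _ huv =>
    Subtype.ext (hm.1.invol.injective (congrArg Subtype.val huv))
  have hadj : (G.induce (geC G)).Adj v (f v) :=
    hm.1.adj v (hm.apply_ne fun hD => v.2 (Or.inl hD))
  exact (Bool.eq_not_of_ne (c.valid hadj.symm)).trans (congrArg _ hv)

theorem ncard_colorClass_not (c : (G.induce (geC G)).Coloring Bool) (b : Bool) :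
    (c.colorClass !b).ncard = (c.colorClass b).ncard := by
  obtain ⟨m, hm⟩ := exists_isMaxPairing G
  refine le_antisymm ?_ (hm.ncard_colorClass_le c b)
  simpa only [Bool.not_not] using hm.ncard_colorClass_le c !b

theorem two_mul_ncard_colorClass (c : (G.induce (geC G)).Coloring Bool) (b : Bool) :
    2 * (c.colorClass b).ncard = (geC G).ncard := by
  have hcompl : c.colorClass (!b) = (c.colorClass b)ᶜ := by
    ext v
    exact Bool.eq_not
  rw [← Nat.card_coe_set_eq (geC G), ← Set.ncard_add_ncard_compl (c.colorClass b), ← hcompl,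
    ncard_colorClass_not, two_mul]

end Critical

section Nucleus

variable {V : Type*} {G : SimpleGraph V} {c : (G.induce (geC G)).Coloring Bool} {b : Bool}

/-- The set `X` together with one colour class of `G[C]`, a maximum critical independent set. -/
def colorSet (c : (G.induce (geC G)).Coloring Bool) (b : Bool) : Set V :=
  setX G ∪ Subtype.val '' c.colorClass b

theorem isIndepSet_colorSet : G.IsIndepSet (colorSet c b) := by
  rintro u (hu | ⟨u, hu, rfl⟩) v (hv | ⟨v, hv, rfl⟩) - huv
  · exact hu.2 v hv.1 huv
  · exact not_adj_of_mem_geD_of_mem_geC hu.1 v.2 huv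
  · exact not_adj_of_mem_geD_of_mem_geC hv.1 u.2 huv.symm
  · exact c.valid (v := u) (w := v) huv (hu.trans hv.symm)

theorem nbhd_colorSet_subset :
    nbhd G (colorSet c b) ⊆ geA G ∪ Subtype.val '' c.colorClass !b := by
  rintro v ⟨u, hu | ⟨u, hu, rfl⟩, huv⟩
  · exact Or.inl (nbhd_setX_subset_geA ⟨u, hu, huv⟩)
  · by_cases hvA : v ∈ geA G
    · exact Or.inl hvA
    · have hvC : v ∈ geC G := fun h =>
        not_adj_of_mem_geD_of_mem_geC (h.resolve_right hvA) u.2 huv.symm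
      refine Or.inr ⟨⟨v, hvC⟩, ?_, rfl⟩
      rw [← show c u = b from hu]
      exact Bool.eq_not_of_ne (c.valid (v := ⟨v, hvC⟩) (w := u) huv.symm)

theorem iInter_colorSet_subset : ⋂ b, colorSet c b ⊆ setX G := by
  intro v hv
  rw [Set.mem_iInter] at hv
  obtain hX | ⟨u, hu, rfl⟩ := hv true
  · exact hX
  obtain hX | ⟨w, hw, hwu⟩ := hv false
  · exact hX
  rw [Subtype.val_injective hwu] at hw
  exact (Bool.false_ne_true (hw.symm.trans hu)).elim

variable [Finite V]

theorem ncard_colorSet : (colorSet c b).ncard = (setX G).ncard + (c.colorClass b).ncard := by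
  rw [colorSet, Set.ncard_union_eq, Set.ncard_image_of_injective _ Subtype.val_injective]
  refine Set.disjoint_left.2 ?_
  rintro _ hX ⟨u, -, rfl⟩
  exact u.2 (Or.inl hX.1)

theorem HasAdaptedPairings.isCriticalIndep_colorSet (h : HasAdaptedPairings G) :
    IsCriticalIndep G (colorSet c b) := by
  refine h.isCriticalIndep_iff.2 ⟨isIndepSet_colorSet, ?_⟩
  have hnbhd := (Set.ncard_le_ncard (nbhd_colorSet_subset (c := c) (b := b))).trans
    (Set.ncard_union_le _ _)
  rw [Set.ncard_image_of_injective _ Subtype.val_injective, ncard_colorClass_not] at hnbhd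
  rw [diff, diff, ← h.geA_eq, ncard_colorSet]
  omega

theorem HasAdaptedPairings.two_mul_ncard_le (h : HasAdaptedPairings G) {S : Set V}
    (hS : IsCriticalIndep G S) : 2 * S.ncard ≤ 2 * (setX G).ncard + (geC G).ncard := by
  have hsub : S ∪ nbhd G S ⊆ setX G ∪ geA G ∪ geC G := by
    have hY := (h.disjoint_setY hS).union_left (h.disjoint_nbhd_setY hS)
    intro v hv
    have hvY : v ∉ geD G \ setX G := Set.disjoint_left.1 hY hv
    simp only [geC, Set.mem_union, Set.mem_compl_iff, Set.mem_sdiff] at hvY ⊢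
    tauto
  have hcard := (Set.ncard_le_ncard hsub).trans ((Set.ncard_union_le _ _).trans
    (Nat.add_le_add_right (Set.ncard_union_le _ _) _))
  rw [Set.ncard_union_eq (disjoint_nbhd_of_isIndepSet hS.1)] at hcard
  have hdiff := h.diff_le hS.1
  rw [diff, diff, ← h.geA_eq] at hdiff
  omega

theorem HasAdaptedPairings.isMaximumCriticalIndep_colorSet (h : HasAdaptedPairings G) :
    IsMaximumCriticalIndep G (colorSet c b) := by
  refine ⟨h.isCriticalIndep_colorSet, fun S hS => ?_⟩
  have := h.two_mul_ncard_le hS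
  have := two_mul_ncard_colorClass c b
  rw [ncard_colorSet]
  omega

theorem HasAdaptedPairings.nucleus_subset (h : HasAdaptedPairings G)
    (hC : (G.induce (geC G)).IsBipartite) : nucleus G ⊆ geD G := by
  let c : (G.induce (geC G)).Coloring Bool := Colorable.toColoring hC (by simp)
  intro v hv
  have hX : v ∈ setX G := iInter_colorSet_subset (c := c)
    (Set.mem_iInter.2 fun b => hv _ h.isMaximumCriticalIndep_colorSet)
  exact hX.1

theorem HasAdaptedPairings.closedNbhd_diadem_eq (h : HasAdaptedPairings G)
    (hC : (G.induce (geC G)).IsBipartite) : closedNbhd G (diadem G) = (setY G)ᶜ := by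
  let c : (G.induce (geC G)).Coloring Bool := Colorable.toColoring hC (by simp)
  have colorSet_subset : ∀ b, colorSet c b ⊆ diadem G :=
    fun b v hv => ⟨_, h.isCriticalIndep_colorSet, hv⟩
  have setX_subset : setX G ⊆ diadem G :=
    fun v hv => colorSet_subset true (Or.inl hv)
  refine Set.Subset.antisymm (Set.union_subset ?_ ?_) fun v hv => ?_
  · rintro v ⟨S, hS, hvS⟩
    exact Set.disjoint_left.1 (h.disjoint_setY hS) hvS
  · rintro v ⟨u, ⟨S, hS, huS⟩, huv⟩
    exact Set.disjoint_left.1 (h.disjoint_nbhd_setY hS) ⟨u, huS, huv⟩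
  · by_cases hvC : v ∈ geC G
    · exact Or.inl (colorSet_subset (c ⟨v, hvC⟩) (Or.inr ⟨⟨v, hvC⟩, rfl, rfl⟩))
    obtain hvD | hvA := not_not.1 hvC
    · exact Or.inl (setX_subset (by_contra fun hvX => hv ⟨hvD, hvX⟩))
    · obtain ⟨u, hu, huv⟩ := h.geA_eq ▸ hvA
      exact Or.inr ⟨u, setX_subset hu, huv⟩

end Nucleus

section Glue

variable {V ι : Type*} {G : SimpleGraph V} {idx : V → ι} {i : ι}
  {M : ∀ i, idx ⁻¹' {i} → idx ⁻¹' {i}}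

/-- The subgraph of `G` induced on the fibre of `idx` over `i`. A partition of the vertices is
encoded as the fibres of a map. -/
abbrev piece (G : SimpleGraph V) (idx : V → ι) (i : ι) : SimpleGraph (idx ⁻¹' {i}) :=
  G.induce (idx ⁻¹' {i})

/-- For each piece `H`, no edge of `G` leaves `H` at a vertex of `D(H)`. -/
def IsDSeparated (G : SimpleGraph V) (idx : V → ι) : Prop :=
  ∀ i, ∀ x ∈ geD (piece G idx i), ∀ w, G.Adj x w → idx w = i

/-- The map that is `M i` on the fibre over `i`. -/
def glue (M : ∀ i, idx ⁻¹' {i} → idx ⁻¹' {i}) (v : V) : V := M (idx v) ⟨v, rfl⟩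

theorem glue_coe (x : idx ⁻¹' {i}) : glue M x = M i x := by
  obtain ⟨v, rfl⟩ := x
  rfl

theorem coe_mem_fixedPoints_glue {x : idx ⁻¹' {i}} :
    (x : V) ∈ fixedPoints (glue M) ↔ x ∈ fixedPoints (M i) := by
  rw [mem_fixedPoints, IsFixedPt, glue_coe, Subtype.coe_inj, mem_fixedPoints, IsFixedPt]

theorem IsPairing.glue (hM : ∀ i, IsPairing (piece G idx i) (M i)) : IsPairing G (glue M) := by
  refine ⟨fun v => ?_, fun v hv => (hM (idx v)).adj ⟨v, rfl⟩ fun h => hv (congrArg _ h)⟩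
  exact (glue_coe _).trans (congrArg Subtype.val ((hM (idx v)).invol ⟨v, rfl⟩))

/-- The fixed points of a glued map are those of its parts. -/
def fixedPointsGlueEquiv (M : ∀ i, idx ⁻¹' {i} → idx ⁻¹' {i}) :
    fixedPoints (glue M) ≃ Σ i, fixedPoints (M i) where
  toFun v := ⟨idx v, ⟨v, rfl⟩, Subtype.ext v.2⟩
  invFun x := ⟨x.2, coe_mem_fixedPoints_glue.2 x.2.2⟩
  left_inv _ := rfl
  right_inv := by
    rintro ⟨i, ⟨v, rfl⟩, h⟩
    rfl

theorem exists_isPairing_piece {m : V → V} (hm : IsPairing G m) (i : ι) :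
    ∃ n, IsPairing (piece G idx i) n ∧
      ∀ x : idx ⁻¹' {i}, n x = x → idx (m x) = i → m x = x := by
  classical
  let n : idx ⁻¹' {i} → idx ⁻¹' {i} := fun x => if h : idx (m x) = i then ⟨m x, h⟩ else x
  have coe_apply : ∀ x : idx ⁻¹' {i}, idx (m x) = i → (n x : V) = m x := fun x h => by
    simp only [n, dif_pos h]
  refine ⟨n, ⟨fun x => ?_, fun x hx => ?_⟩, fun x hx h => ?_⟩
  · by_cases h : idx (m x) = i
    · refine Subtype.ext ?_
      rw [coe_apply, coe_apply x h, hm.invol]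
      rw [coe_apply x h, hm.invol]
      exact x.2
    · simp only [n, dif_neg h]
  · by_cases h : idx (m x) = i
    · rw [induce_adj, coe_apply x h]
      exact hm.adj x fun hmx => hx (Subtype.ext ((coe_apply x h).trans hmx))
    · exact (hx (dif_neg h)).elim
  · rw [← coe_apply x h, hx]

variable [Finite V]

theorem ncard_fixedPoints_glue_eq {M' : ∀ i, idx ⁻¹' {i} → idx ⁻¹' {i}}
    (h : ∀ i, (fixedPoints (M i)).ncard = (fixedPoints (M' i)).ncard) :
    (fixedPoints (glue M)).ncard = (fixedPoints (glue M')).ncard :=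
  Nat.card_congr <| (fixedPointsGlueEquiv M).trans <|
    (Equiv.sigmaCongrRight fun i => (Finite.card_eq.1 (h i)).some).trans
      (fixedPointsGlueEquiv M').symm

theorem IsDSeparated.exists_fixedPoints_glue_subset (h : IsDSeparated G idx) {m : V → V}
    (hm : IsPairing G m) : ∃ M : ∀ i, idx ⁻¹' {i} → idx ⁻¹' {i},
      (∀ i, IsMaxPairing (piece G idx i) (M i)) ∧ fixedPoints (glue M) ⊆ fixedPoints m := by
  choose n hn hnm using fun i => exists_isPairing_piece (idx := idx) hm i
  choose M hM hMn using fun i => exists_isMaxPairing_fixedPoints_subset (hn i)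
  refine ⟨M, hM, fun v hv => by_contra fun hmv => ?_⟩
  let x : idx ⁻¹' {idx v} := ⟨v, rfl⟩
  have hx : x ∈ fixedPoints (M (idx v)) := coe_mem_fixedPoints_glue.1 hv
  have hmx : idx (m x) = idx v := h _ x ((hM _).mem_geD hx) _ (hm.adj v hmv)
  exact hmv (hnm _ x (hMn _ hx) hmx)

theorem IsDSeparated.isMaxPairing_glue (h : IsDSeparated G idx)
    (hM : ∀ i, IsMaxPairing (piece G idx i) (M i)) : IsMaxPairing G (glue M) := by
  obtain ⟨m, hm⟩ := exists_isMaxPairing G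
  obtain ⟨M', hM', hsub⟩ := h.exists_fixedPoints_glue_subset hm.1
  refine hm.of_ncard_le (IsPairing.glue fun i => (hM i).1) ?_
  rw [ncard_fixedPoints_glue_eq fun i => (hM i).ncard_eq (hM' i)]
  exact Set.ncard_le_ncard hsub

theorem IsDSeparated.coe_mem_geD_iff (h : IsDSeparated G idx) {x : idx ⁻¹' {i}} :
    (x : V) ∈ geD G ↔ x ∈ geD (piece G idx i) := by
  classical
  refine ⟨fun hx => ?_, fun hx => ?_⟩
  · obtain ⟨m, hm, hmx⟩ := mem_geD_iff.1 hx
    obtain ⟨M, hM, hsub⟩ := h.exists_fixedPoints_glue_subset hm.1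
    have heq := (h.isMaxPairing_glue hM).fixedPoints_eq_of_subset hm hsub
    exact (hM i).mem_geD (coe_mem_fixedPoints_glue.1 (heq ▸ hmx))
  · obtain ⟨n, hn, hnx⟩ := mem_geD_iff.1 hx
    choose M hM using fun j => exists_isMaxPairing (piece G idx j)
    have hmax : IsMaxPairing G (glue (update M i n)) := h.isMaxPairing_glue fun j => by
      obtain rfl | hj := eq_or_ne j i
      · rwa [update_self]
      · rw [update_of_ne hj]
        exact hM j
    exact hmax.mem_geD (by rw [glue_coe, update_self, hnx])

theorem IsDSeparated.idx_eq (h : IsDSeparated G idx) {u v : V} (hu : u ∈ geD G)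
    (huv : G.Adj u v) : idx v = idx u :=
  h _ ⟨u, rfl⟩ (h.coe_mem_geD_iff.1 hu) v huv

theorem IsDSeparated.exists_mem_geD_iff (h : IsDSeparated G idx) {x : idx ⁻¹' {i}} :
    (∃ u ∈ geD G, G.Adj u x) ↔ ∃ u ∈ geD (piece G idx i), (piece G idx i).Adj u x := by
  refine ⟨fun ⟨u, hu, hux⟩ => ?_, fun ⟨u, hu, hux⟩ => ⟨u, h.coe_mem_geD_iff.2 hu, hux⟩⟩
  have hidx : idx u = i := (h.idx_eq hu hux).symm.trans x.2
  exact ⟨⟨u, hidx⟩, h.coe_mem_geD_iff.1 hu, hux⟩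

theorem IsDSeparated.coe_mem_geA_iff (h : IsDSeparated G idx) {x : idx ⁻¹' {i}} :
    (x : V) ∈ geA G ↔ x ∈ geA (piece G idx i) :=
  and_congr (not_congr h.coe_mem_geD_iff) h.exists_mem_geD_iff

theorem IsDSeparated.coe_mem_geC_iff (h : IsDSeparated G idx) {x : idx ⁻¹' {i}} :
    (x : V) ∈ geC G ↔ x ∈ geC (piece G idx i) :=
  not_congr (or_congr h.coe_mem_geD_iff h.coe_mem_geA_iff)

theorem IsDSeparated.coe_mem_setY_iff (h : IsDSeparated G idx) {x : idx ⁻¹' {i}} :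
    (x : V) ∈ setY G ↔ x ∈ setY (piece G idx i) := by
  simp only [mem_setY_iff, G.adj_comm x, (piece G idx i).adj_comm x]
  exact and_congr h.coe_mem_geD_iff h.exists_mem_geD_iff

theorem IsDSeparated.coe_mem_setX_iff (h : IsDSeparated G idx) {x : idx ⁻¹' {i}} :
    (x : V) ∈ setX G ↔ x ∈ setX (piece G idx i) := by
  rw [← geD_sdiff_setY, ← geD_sdiff_setY]
  exact and_congr h.coe_mem_geD_iff (not_congr h.coe_mem_setY_iff)

theorem IsDSeparated.isAdapted_glue (h : IsDSeparated G idx) {S : Set V}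
    (hM : ∀ i, IsAdapted (piece G idx i) (Subtype.val ⁻¹' S) (M i)) :
    IsAdapted G S (glue M) where
  max := h.isMaxPairing_glue fun i => (hM i).max
  mapsTo a ha := by
    have ha' : (⟨a, rfl⟩ : idx ⁻¹' {idx a}) ∈ geA (piece G idx (idx a)) := h.coe_mem_geA_iff.1 ha
    exact h.coe_mem_setX_iff.2 ((hM _).mapsTo ha')
  notMem v hv hMv :=
    (hM (idx v)).notMem ⟨v, rfl⟩ (h.coe_mem_setY_iff.1 hv) (coe_mem_fixedPoints_glue.1 hMv)
  exists_fixed := by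
    rintro ⟨v, ⟨u, hu, huv⟩, hvY⟩
    have hidx : idx u = idx v := h.idx_eq hvY.1 huv.symm
    obtain ⟨w, ⟨⟨z, hz, hzw⟩, hwY⟩, hMw⟩ := (hM (idx v)).exists_fixed
      ⟨⟨v, rfl⟩, ⟨⟨u, hidx⟩, hu, huv⟩, h.coe_mem_setY_iff.1 hvY⟩
    exact ⟨w, ⟨⟨z, hz, hzw⟩, h.coe_mem_setY_iff.2 hwY⟩, coe_mem_fixedPoints_glue.2 hMw⟩

theorem IsDSeparated.hasAdaptedPairings (h : IsDSeparated G idx)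
    (hpiece : ∀ i, HasAdaptedPairings (piece G idx i)) : HasAdaptedPairings G := by
  intro S hS
  choose M hM using fun i => hpiece i (Subtype.val ⁻¹' S)
    fun u hu v hv huv => hS hu hv (Subtype.coe_ne_coe.2 huv)
  exact ⟨glue M, h.isAdapted_glue hM⟩

theorem IsDSeparated.isBipartite_induce_geC (h : IsDSeparated G idx)
    (hpiece : ∀ j ≠ i, geC (piece G idx j) = ∅) (hi : (piece G idx i).IsBipartite) :
    (G.induce (geC G)).IsBipartite := by
  have hidx : ∀ v ∈ geC G, idx v = i := fun v hv => by_contra fun hvi => by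
    have : (⟨v, rfl⟩ : idx ⁻¹' {idx v}) ∈ geC (piece G idx (idx v)) := h.coe_mem_geC_iff.1 hv
    rw [hpiece _ hvi] at this
    exact this
  exact hi.of_hom (induceHomOfLE G hidx).toHom

end Glue

section OddCycle

variable {V : Type*} {G : SimpleGraph V} {C : G.Subgraph}

theorem exists_isPath_or_isOddCycle {u v : V} (p : G.Walk u v) :
    (∃ q : G.Walk u v, q.IsPath ∧ (Even q.length ↔ Even p.length)) ∨ ∃ C, IsOddCycle G C := by
  classical
  induction p with
  | nil => exact Or.inl ⟨Walk.nil, Walk.IsPath.nil, Iff.rfl⟩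
  | @cons u w v h p ih =>
    obtain ⟨q, hq, hparity⟩ | hC := ih
    · by_cases hu : u ∈ q.support
      · have hlength : q.length = (q.takeUntil u hu).length + (q.dropUntil u hu).length := by
          rw [← Walk.length_append, q.take_spec hu]
        by_cases heven : Even (q.takeUntil u hu).length
        · have hcycle : (Walk.cons h (q.takeUntil u hu)).IsCycle := by
            refine Walk.cons_isCycle_iff _ h |>.2 ⟨hq.takeUntil hu, fun hmem => ?_⟩
            rw [Sym2.eq_swap] at hmem
            rw [(hq.takeUntil hu).length_eq_one_of_mem_edges hmem] at heven
            exact absurd heven (by decide)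
          exact Or.inr ⟨_, u, _, hcycle, heven.add_one, rfl⟩
        · refine Or.inl ⟨q.dropUntil u hu, hq.dropUntil hu, ?_⟩
          rw [Walk.length_cons, Nat.even_add_one, ← hparity, hlength, Nat.even_add]
          tauto
      · exact Or.inl ⟨Walk.cons h q, hq.cons hu, by
          simp only [Walk.length_cons, Nat.even_add_one, hparity]⟩
    · exact Or.inr hC

theorem isBipartite_of_forall_not_isOddCycle (h : ∀ C, ¬ IsOddCycle G C) : G.IsBipartite := by
  refine two_colorable_iff_forall_loop_even.2 fun u w => ?_
  obtain ⟨q, hq, hparity⟩ | ⟨C, hC⟩ := exists_isPath_or_isOddCycle w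
  · rw [← hparity, Walk.length_eq_zero_iff.2 (Walk.isPath_iff_nil.1 hq)]
    exact Even.zero
  · exact (h C hC).elim

theorem isBipartite_deleteEdges (hC : ∀ C', IsOddCycle G C' → C' = C) {x y : V}
    (hxy : C.Adj x y) : (G.deleteEdges {s(x, y)}).IsBipartite := by
  refine isBipartite_of_forall_not_isOddCycle ?_
  rintro _ ⟨u, p, hp, hodd, -⟩
  have hle : G.deleteEdges {s(x, y)} ≤ G := deleteEdges_le _
  have hmem : s(x, y) ∈ C.edgeSet := hxy
  rw [← hC _ ⟨u, p.mapLe hle, hp.mapLe hle, by simpa using hodd, rfl⟩,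
    Walk.mem_edges_toSubgraph, Walk.edges_mapLe_eq_edges] at hmem
  simpa using p.edges_subset_edgeSet hmem

theorem IsOddCycle.exists_walk (hC : IsOddCycle G C) {b : V} (hb : b ∈ C.verts) :
    ∃ p : G.Walk b b, p.IsCycle ∧ Odd p.length ∧ p.toSubgraph = C := by
  classical
  obtain ⟨u, p, hp, hodd, rfl⟩ := hC
  rw [Walk.mem_verts_toSubgraph] at hb
  exact ⟨p.rotate b hb, (Walk.isCycle_rotate hb).2 hp, by rwa [Walk.length_rotate],
    p.toSubgraph_rotate hb⟩

theorem IsOddCycle.verts_nonempty (hC : IsOddCycle G C) : C.verts.Nonempty := by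
  obtain ⟨u, p, -, -, rfl⟩ := hC
  exact ⟨u, p.start_mem_verts_toSubgraph⟩

theorem IsOddCycle.ncard_neighborSet (hC : IsOddCycle G C) {z : V} (hz : z ∈ C.verts) :
    (C.neighborSet z).ncard = 2 := by
  obtain ⟨p, hp, -, rfl⟩ := hC.exists_walk hz
  exact hp.ncard_neighborSet_toSubgraph_eq_two p.start_mem_support

theorem IsOddCycle.exists_adj_ne (hC : IsOddCycle G C) {z : V} (hz : z ∈ C.verts) (w : V) :
    ∃ y, C.Adj z y ∧ y ≠ w :=
  Set.exists_ne_of_one_lt_ncard (s := C.neighborSet z)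
    (by rw [hC.ncard_neighborSet hz]; exact one_lt_two) w

theorem IsMaxPairing.deleteEdges {m : V → V} (hm : IsMaxPairing G m) {x y : V} (h : m x ≠ y) :
    IsMaxPairing (G.deleteEdges {s(x, y)}) m := by
  refine ⟨⟨hm.1.invol, fun v hv => ?_⟩, fun m' hm' => hm.2 _ (hm'.mono (deleteEdges_le _))⟩
  rw [deleteEdges_adj]
  refine ⟨hm.1.adj v hv, fun hmem => ?_⟩
  rw [Set.mem_singleton_iff, Sym2.eq_iff] at hmem
  rcases hmem with ⟨rfl, hmv⟩ | ⟨rfl, hmv⟩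
  · exact h hmv
  · exact h (by rw [← hmv, hm.1.invol])

variable [Finite V]

theorem IsOddCycle.ncard_verts (hC : IsOddCycle G C) : C.verts.ncard = C.edgeSet.ncard := by
  have := ncard_verts_mul_of_ncard_neighborSet C 2 fun _ => hC.ncard_neighborSet
  omega

theorem IsOddCycle.odd_ncard_verts (hC : IsOddCycle G C) : Odd C.verts.ncard := by
  classical
  rw [hC.ncard_verts]
  obtain ⟨u, p, hp, hodd, rfl⟩ := hC
  have : p.toSubgraph.edgeSet = p.edges.toFinset := by
    ext e
    simp
  rwa [this, Set.ncard_coe_finset, List.toFinset_card_of_nodup hp.isTrail.edges_nodup,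
    Walk.length_edges]

theorem IsPairing.even_ncard {m : V → V} (hm : IsPairing G m) {S : Set V}
    (hmaps : Set.MapsTo m S S) (hne : ∀ v ∈ S, m v ≠ v) : Even S.ncard := by
  let M : G.Subgraph :=
    { verts := S
      Adj := fun v w => v ∈ S ∧ m v = w
      adj_sub := by
        rintro v w ⟨hv, rfl⟩
        exact hm.adj v (hne v hv)
      edge_vert := fun h => h.1
      symm := ⟨by
        rintro v w ⟨hv, rfl⟩
        exact ⟨hmaps hv, hm.invol v⟩⟩ }
  have hM : M.IsMatching := fun v hv => ⟨m v, ⟨hv, rfl⟩, fun _ h => h.2.symm⟩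
  exact ⟨M.edgeSet.ncard, by rw [← two_mul]; exact ncard_verts_of_isMatching hM⟩

theorem IsOddCycle.exists_not_adj_apply (hC : IsOddCycle G C) {m : V → V} (hm : IsPairing G m) :
    ∃ z ∈ C.verts, ¬ C.Adj z (m z) := by
  by_contra! h
  refine Nat.not_even_iff_odd.2 hC.odd_ncard_verts
    (hm.even_ncard (fun v hv => (h v hv).snd_mem) fun v hv => (h v hv).ne.symm)

theorem IsOddCycle.exists_adj_apply_ne (hC : IsOddCycle G C) {m m' : V → V}
    (hm : IsPairing G m) : ∃ x y, C.Adj x y ∧ m x ≠ y ∧ m' x ≠ y := by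
  obtain ⟨x, hx, hmx⟩ := hC.exists_not_adj_apply hm
  obtain ⟨y, hxy, hy⟩ := hC.exists_adj_ne hx (m' x)
  exact ⟨x, y, hxy, fun h => hmx (h ▸ hxy), hy.symm⟩

/-- An edge of the odd cycle avoided by both matchings can be deleted, which reduces the claim to
bipartite graphs. -/
theorem IsOddCycle.adj_of_mem_geD (hC : IsOddCycle G C) (hunique : ∀ C', IsOddCycle G C' → C' = C)
    {u v : V} (hu : u ∈ geD G) (hv : v ∈ geD G) (huv : G.Adj u v) : C.Adj u v := by
  obtain ⟨m, hm, hmu⟩ := mem_geD_iff.1 hu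
  obtain ⟨m', hm', hmv⟩ := mem_geD_iff.1 hv
  obtain ⟨x, y, hxy, hmx, hmx'⟩ := hC.exists_adj_apply_ne (m' := m') hm.1
  have hnot_adj := not_adj_of_mem_geD_of_isBipartite (isBipartite_deleteEdges hunique hxy)
    ((hm.deleteEdges hmx).mem_geD hmu) ((hm'.deleteEdges hmx').mem_geD hmv)
  rw [deleteEdges_adj, not_and_not_right] at hnot_adj
  rwa [← Subgraph.mem_edgeSet, show s(u, v) = s(x, y) from hnot_adj huv]

end OddCycle

section NearPerfect

variable {V : Type*} {G : SimpleGraph V} {C : G.Subgraph} {m : V → V} {b : V}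

/-- A maximum pairing that misses the vertex `b` of `C` and pairs off the other vertices of `C`
along edges of `C`. For an odd cycle `C`, this says that `C` is a flower with base `b` and trivial
stem. -/
structure IsNearPerfectOn (G : SimpleGraph V) (C : G.Subgraph) (m : V → V) (b : V) : Prop where
  max : IsMaxPairing G m
  mem : b ∈ C.verts
  fix : m b = b
  adj : ∀ z ∈ C.verts, z ≠ b → C.Adj z (m z)

theorem IsNearPerfectOn.apply_notMem_verts (h : IsNearPerfectOn G C m b) {a : V}
    (ha : a ∉ C.verts) : m a ∉ C.verts := by
  intro hmem
  by_cases hb : m a = b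
  · rw [← h.max.1.invol a, hb, h.fix] at ha
    exact ha h.mem
  · have := (h.adj _ hmem hb).snd_mem
    rw [h.max.1.invol] at this
    exact ha this

variable [Finite V]

theorem IsNearPerfectOn.rematch (h : IsNearPerfectOn G C m b) {x : V} (hx : C.Adj b x) :
    IsNearPerfectOn G C (rematch m b x) (m x) where
  max := h.max.rematch h.fix hx.adj_sub
  mem := (h.adj x hx.snd_mem hx.ne.symm).snd_mem
  fix := h.max.1.rematch_apply h.fix hx.ne (h.max.apply_ne_of_adj h.fix hx.adj_sub)
  adj z hz hzx := by
    by_cases hb : z = b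
    · rwa [hb, rematch_left]
    · by_cases hzx' : z = x
      · rw [hzx', rematch_right]
        exact hx.symm
      · rw [rematch_apply_of_ne hb hzx' hzx]
        exact h.adj z hz hb

theorem IsNearPerfectOn.exists_getVert {p : G.Walk b b} (hp : p.IsCycle)
    (h : IsNearPerfectOn G p.toSubgraph m b) (k : ℕ) (hk : 2 * k < p.length) :
    ∃ m', IsNearPerfectOn G p.toSubgraph m' (p.getVert (2 * k)) := by
  induction k with
  | zero => exact ⟨m, by rwa [mul_zero, p.getVert_zero]⟩
  | succ k ih =>
    obtain ⟨m', hm'⟩ := ih (by omega)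
    have hadj : p.toSubgraph.Adj (p.getVert (2 * k)) (p.getVert (2 * k + 1)) :=
      p.toSubgraph_adj_getVert (by omega)
    have hadj' : p.toSubgraph.Adj (p.getVert (2 * k + 1)) (p.getVert (2 * (k + 1))) :=
      p.toSubgraph_adj_getVert (by omega)
    set x := p.getVert (2 * k + 1)
    have hne : p.getVert (2 * k) ≠ p.getVert (2 * (k + 1)) := fun heq => by
      have := hp.getVert_injOn' (Set.mem_ofPred_eq ▸ by omega) (Set.mem_ofPred_eq ▸ by omega) heq
      omega
    have hneighbor : p.toSubgraph.neighborSet x = {p.getVert (2 * k), p.getVert (2 * (k + 1))} := by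
      refine (Set.eq_of_subset_of_ncard_le ?_ ?_).symm
      · exact Set.insert_subset hadj.symm (Set.singleton_subset_iff.2 hadj')
      · rw [Set.ncard_pair hne, hp.ncard_neighborSet_toSubgraph_eq_two
          ((Walk.mem_verts_toSubgraph p).1 hadj'.fst_mem)]
    have hmx : m' x ∈ p.toSubgraph.neighborSet x := hm'.adj x hadj.snd_mem hadj.ne.symm
    rw [hneighbor] at hmx
    obtain hmx | hmx := hmx
    · have : x = p.getVert (2 * k) := by rw [← hm'.max.1.invol x, hmx, hm'.fix]
      exact (hadj.ne this.symm).elim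
    · exact ⟨_, hmx ▸ hm'.rematch hadj⟩

theorem IsNearPerfectOn.exists_of_mem (h : IsNearPerfectOn G C m b) (hC : IsOddCycle G C) {z : V}
    (hz : z ∈ C.verts) : ∃ m', IsNearPerfectOn G C m' z := by
  obtain ⟨p, hp, hodd, rfl⟩ := hC.exists_walk h.mem
  obtain ⟨j, rfl, hj⟩ := Walk.mem_support_iff_exists_getVert.1 ((p.mem_verts_toSubgraph).1 hz)
  obtain ⟨n, hn⟩ := hodd
  obtain ⟨k, rfl | rfl⟩ := Nat.even_or_odd' j
  · exact h.exists_getVert hp k (by omega)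
  · have hreverse := p.getVert_reverse (2 * (n - k))
    rw [show p.length - 2 * (n - k) = 2 * k + 1 by omega] at hreverse
    rw [← hreverse, ← p.toSubgraph_reverse]
    rw [← p.toSubgraph_reverse] at h
    exact h.exists_getVert hp.reverse _ (by rw [Walk.length_reverse]; omega)

theorem IsOddCycle.mapsTo_geA_setX (hC : IsOddCycle G C)
    (hunique : ∀ C', IsOddCycle G C' → C' = C) (h : IsNearPerfectOn G C m b) :
    Set.MapsTo m (geA G) (setX G) := by
  intro a ha
  have hmem := h.max.apply_mem_geD ha
  have ha' : a ∉ C.verts := fun hmem => by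
    obtain ⟨m', hm'⟩ := h.exists_of_mem hC hmem
    exact ha.1 (hm'.max.mem_geD hm'.fix)
  exact ⟨hmem, fun u hu hadj =>
    h.apply_notMem_verts ha' (hC.adj_of_mem_geD hunique hmem hu hadj).fst_mem⟩

end NearPerfect

section Flower

variable {V : Type*} {G : SimpleGraph V} {M C : G.Subgraph} {b r : V}

theorem IsAlternatingWalk.reverse {p : G.Walk b r} (hp : IsAlternatingWalk G M p) :
    IsAlternatingWalk G M p.reverse := by
  rw [IsAlternatingWalk, Walk.edges_reverse, List.isChain_reverse]
  exact hp.imp fun _ _ => fun h => (xor_comm _ _).mp h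

theorem IsAlternatingWalk.adj_getVert_iff_odd {w : G.Walk r b} (hw : IsAlternatingWalk G M w)
    (hr : r ∉ M.verts) {i : ℕ} (hi : i < w.length) :
    M.Adj (w.getVert i) (w.getVert (i + 1)) ↔ Odd i := by
  induction i with
  | zero => simpa using fun h : M.Adj r _ => hr h.fst_mem
  | succ i ih =>
    have halt := List.isChain_iff_getElem.1 hw i (by rwa [Walk.length_edges])
    rw [Walk.getElem_edges, Walk.getElem_edges, Subgraph.mem_edgeSet, Subgraph.mem_edgeSet,
      ih (by omega), xor_iff_not_iff', Nat.not_odd_iff_even] at halt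
    rw [← halt, Nat.odd_add_one, Nat.not_odd_iff_even]

variable [Finite V]

/-- Switching the matching along an initial segment of an alternating path moves the unsaturated
vertex to the end of that segment. -/
theorem IsMaxPairing.exists_apply_getVert {m : V → V} (hm : IsMaxPairing G m) {w : G.Walk r b}
    (hw : w.IsPath) (hr : m r = r)
    (hmw : ∀ i, Odd i → i < w.length → m (w.getVert i) = w.getVert (i + 1)) (k : ℕ)
    (hk : 2 * k ≤ w.length) :
    ∃ m', IsMaxPairing G m' ∧ m' (w.getVert (2 * k)) = w.getVert (2 * k) ∧
      ∀ z, (∀ j ≤ 2 * k, z ≠ w.getVert j) → m' z = m z := by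
  induction k with
  | zero => exact ⟨m, hm, by rwa [mul_zero, w.getVert_zero], fun _ _ => rfl⟩
  | succ k ih =>
    obtain ⟨m', hm', hfix, hagree⟩ := ih (by omega)
    have hadj := w.adj_getVert_succ (i := 2 * k) (by omega)
    have hx : m' (w.getVert (2 * k + 1)) = w.getVert (2 * (k + 1)) := by
      rw [hagree, hmw _ (odd_two_mul_add_one k) (by omega)]
      · rfl
      · intro j hj heq
        have := hw.getVert_injOn (Set.mem_ofPred_eq ▸ by omega) (Set.mem_ofPred_eq ▸ by omega) heq
        omega
    refine ⟨BAB.rematch m' _ _, hm'.rematch hfix hadj, ?_, fun z hz => ?_⟩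
    · rw [← hx]
      exact hm'.1.rematch_apply hfix hadj.ne (hm'.apply_ne_of_adj hfix hadj)
    · rw [rematch_apply_of_ne (hz _ (by omega)) (hz _ (by omega)) (hx ▸ hz _ le_rfl)]
      exact hagree z fun j hj => hz j (by omega)

theorem IsBlossom.exists_adj_of_ne_base (h : IsBlossom G M C) (hM : M.IsMatching)
    (hb : IsBase G M C b) {z : V} (hz : z ∈ C.verts) (hzb : z ≠ b) :
    ∃ w, C.Adj z w ∧ M.Adj z w := by
  let R : G.Subgraph :=
    { verts := {z | ∃ w, C.Adj z w ∧ M.Adj z w}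
      Adj := fun z w => C.Adj z w ∧ M.Adj z w
      adj_sub := fun h => h.1.adj_sub
      edge_vert := fun h => ⟨_, h⟩
      symm := ⟨fun _ _ h => ⟨h.1.symm, h.2.symm⟩⟩ }
  have hR : R.IsMatching := by
    rintro v ⟨w, hw⟩
    exact ⟨w, hw, fun w' hw' => hM.eq_of_adj_left hw'.2 hw.2⟩
  have hedgeSet : R.edgeSet = C.edgeSet ∩ M.edgeSet := by
    ext e
    induction e with | _ x y => rfl
  have hsub : R.verts ⊆ C.verts \ {b} := by
    rintro v ⟨w, hw⟩
    exact ⟨hw.1.fst_mem, fun hv => hb.2 w (hv ▸ hw)⟩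
  have hcard : (C.verts \ {b}).ncard ≤ R.verts.ncard := by
    have := Set.ncard_sdiff_singleton_add_one hb.1
    have := ncard_verts_of_isMatching hR
    have := h.1.ncard_verts
    have := h.2
    rw [hedgeSet] at *
    omega
  exact (Set.eq_of_subset_of_ncard_le hsub hcard).ge ⟨hz, hzb⟩

theorem IsFlower.exists_isMaxPairing {p : G.Walk b r} (hp : IsFlower G M C p)
    (hM : IsMaximumMatching G M) {k : ℕ} (hk : 2 * k ≤ p.length) :
    ∃ m, IsMaxPairing G m ∧ m (p.reverse.getVert (2 * k)) = p.reverse.getVert (2 * k) ∧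
      ∀ z ∉ p.support, ∀ w, M.Adj z w → m z = w := by
  obtain ⟨-, -, hpath, -, halt, hr, -⟩ := hp
  obtain ⟨m, hm, rfl⟩ := exists_isPairing_toSubgraph_eq hM.1
  obtain ⟨m', hm', hfix, hagree⟩ := IsMaxPairing.exists_apply_getVert
    ((isMaximumMatching_toSubgraph_iff hm).1 hM) hpath.reverse (not_not.1 hr)
    (fun i hi hlt => ((halt.reverse.adj_getVert_iff_odd hr hlt).2 hi).1) k
    (by rwa [Walk.length_reverse])
  refine ⟨m', hm', hfix, fun z hz w hw => (hagree z fun j _ heq => hz ?_).trans hw.1⟩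
  rw [heq, ← List.mem_reverse, ← Walk.support_reverse]
  exact Walk.getVert_mem_support _ _

theorem IsFlower.exists_isNearPerfectOn {p : G.Walk b r} (hp : IsFlower G M C p)
    (hM : IsMaximumMatching G M) : ∃ m, IsNearPerfectOn G C m b := by
  obtain ⟨k, hk⟩ := hp.2.2.2.1
  obtain ⟨m, hm, hfix, hagree⟩ := hp.exists_isMaxPairing hM (k := k) (by omega)
  obtain ⟨hblossom, hbase, -, -, -, -, hdisjoint⟩ := hp
  have hend : p.reverse.getVert (2 * k) = b := by
    rw [p.getVert_reverse, show p.length - 2 * k = 0 by omega, p.getVert_zero]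
  refine ⟨m, hm, hbase.1, hend ▸ hfix, fun z hz hzb => ?_⟩
  obtain ⟨w, hzw, hMzw⟩ := hblossom.exists_adj_of_ne_base hM.1 hbase hz hzb
  rwa [hagree z (fun hmem => hzb (hdisjoint z hmem hz)) w hMzw]

theorem IsFlower.support_subset_closedNbhd_geD {p : G.Walk b r} (hp : IsFlower G M C p)
    (hM : IsMaximumMatching G M) {v : V} (hv : v ∈ p.support) : v ∈ closedNbhd G (geD G) := by
  obtain ⟨n, hn⟩ := hp.2.2.2.1
  have mem_geD : ∀ k, 2 * k ≤ p.length → p.reverse.getVert (2 * k) ∈ geD G := by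
    intro k hk
    obtain ⟨m, hm, hfix, -⟩ := hp.exists_isMaxPairing hM hk
    exact hm.mem_geD hfix
  rw [← List.mem_reverse, ← Walk.support_reverse, Walk.mem_support_iff_exists_getVert,
    Walk.length_reverse] at hv
  obtain ⟨j, rfl, hj⟩ := hv
  obtain ⟨k, rfl | rfl⟩ := Nat.even_or_odd' j
  · exact Or.inl (mem_geD k hj)
  · exact Or.inr ⟨_, mem_geD k (by omega), Walk.adj_getVert_succ _ (by
      rw [Walk.length_reverse]; omega)⟩

theorem IsOddCycle.reachSet_subset_closedNbhd_geD (hC : IsOddCycle G C) :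
    reachSet G C ⊆ closedNbhd G (geD G) := by
  rintro v ⟨M, hM, b, r, p, hp, hv | hv⟩
  · obtain ⟨m, hm⟩ := hp.exists_isNearPerfectOn hM
    obtain ⟨m', hm'⟩ := hm.exists_of_mem hC hv
    exact Or.inl (hm'.max.mem_geD hm'.fix)
  · exact hp.support_subset_closedNbhd_geD hM hv

theorem IsOddCycle.exists_isNearPerfectOn (hC : IsOddCycle G C) (hreach : (reachSet G C).Nonempty)
    {z : V} (hz : z ∈ C.verts) : ∃ m, IsNearPerfectOn G C m z := by
  obtain ⟨-, M, hM, b, r, p, hp, -⟩ := hreach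
  obtain ⟨m, hm⟩ := hp.exists_isNearPerfectOn hM
  exact hm.exists_of_mem hC hz

end Flower

section Pieces

variable {V : Type*} {G : SimpleGraph V} {C : G.Subgraph}

theorem IsOddCycle.exists_mem_verts_notMem (hC : IsOddCycle G C) {S : Set V}
    (hS : G.IsIndepSet S) :
    ∃ z ∈ C.verts, z ∉ S ∧ ((nbhd G S ∩ C.verts).Nonempty → z ∈ nbhd G S) := by
  by_cases hmeet : (nbhd G S ∩ C.verts).Nonempty
  · obtain ⟨z, hz, hzC⟩ := hmeet
    exact ⟨z, hzC, fun hzS => Set.disjoint_left.1 (disjoint_nbhd_of_isIndepSet hS) hzS hz,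
      fun _ => hz⟩
  · obtain ⟨z, hz⟩ := hC.verts_nonempty
    obtain ⟨y, hzy, -⟩ := hC.exists_adj_ne hz z
    exact ⟨z, hz, fun hzS => hmeet ⟨y, ⟨z, hzS, hzy.adj_sub⟩, hzy.snd_mem⟩,
      fun h => (hmeet h).elim⟩

variable [Finite V]

theorem hasAdaptedPairings_of_isBipartite (hG : G.IsBipartite) : HasAdaptedPairings G := by
  have hnot_adj {u v : V} (hu : u ∈ geD G) (hv : v ∈ geD G) : ¬ G.Adj u v :=
    not_adj_of_mem_geD_of_isBipartite hG hu hv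
  have hY : ∀ v, v ∉ setY G := fun v hv => by
    obtain ⟨hvD, u, hu, hvu⟩ := mem_setY_iff.1 hv
    exact hnot_adj hvD hu hvu
  intro S _
  obtain ⟨m, hm⟩ := exists_isMaxPairing G
  exact ⟨m, hm, fun a ha => ⟨hm.apply_mem_geD ha, fun _ hu => hnot_adj (hm.apply_mem_geD ha) hu⟩,
    fun v hv => (hY v hv).elim, fun ⟨v, hv⟩ => (hY v hv.2).elim⟩

theorem IsOddCycle.setY_eq (hC : IsOddCycle G C) (hunique : ∀ C', IsOddCycle G C' → C' = C)
    (hD : C.verts ⊆ geD G) : setY G = C.verts := by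
  ext v
  rw [mem_setY_iff]
  constructor
  · rintro ⟨hv, u, hu, hvu⟩
    exact (hC.adj_of_mem_geD hunique hv hu hvu).fst_mem
  · intro hv
    obtain ⟨u, hvu, -⟩ := hC.exists_adj_ne hv v
    exact ⟨hD hv, u, hD hvu.snd_mem, hvu.adj_sub⟩

theorem IsOddCycle.hasAdaptedPairings (hC : IsOddCycle G C)
    (hunique : ∀ C', IsOddCycle G C' → C' = C) (hreach : (reachSet G C).Nonempty) :
    HasAdaptedPairings G := by
  have hY : setY G = C.verts := hC.setY_eq hunique fun z hz => by
    obtain ⟨m, hm⟩ := hC.exists_isNearPerfectOn hreach hz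
    exact hm.max.mem_geD hm.fix
  intro S hS
  obtain ⟨z, hz, hzS, hznbhd⟩ := hC.exists_mem_verts_notMem hS
  obtain ⟨m, hm⟩ := hC.exists_isNearPerfectOn hreach hz
  refine ⟨m, hm.max, hC.mapsTo_geA_setX hunique hm, fun v hv hmv => ?_, fun hmeet => ?_⟩
  · rw [hY] at hv
    have hvz : v = z := by_contra fun hvz => (hm.adj v hv hvz).ne hmv.symm
    rwa [hvz]
  · rw [hY] at hmeet ⊢
    exact ⟨z, ⟨hznbhd hmeet, hz⟩, hm.fix⟩

theorem IsOddCycle.geC_eq_empty (hC : IsOddCycle G C) (hreach : reachSet G C = Set.univ) :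
    geC G = ∅ := by
  rw [geC, Set.compl_empty_iff, Set.eq_univ_iff_forall]
  intro v
  by_cases hv : v ∈ geD G
  · exact Or.inl hv
  · have : v ∈ closedNbhd G (geD G) := hC.reachSet_subset_closedNbhd_geD (hreach ▸ Set.mem_univ v)
    exact Or.inr ⟨hv, this.resolve_left hv⟩

end Pieces

section Decomposition

variable {V : Type*} {G : SimpleGraph V} {k : ℕ} {B : Set V} {P : Fin k → Set V}

theorem IsBABDecomposition.exists_index (h : IsBABDecomposition G B P) :
    ∃ idx : V → Option (Fin k), B = idx ⁻¹' {none} ∧ P = fun i => idx ⁻¹' {some i} := by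
  have hcover : ∀ v, ∃ o : Option (Fin k), v ∈ o.elim B P := fun v => by
    obtain hv | hv := h.cover.ge (Set.mem_univ v)
    · exact ⟨none, hv⟩
    · exact (Set.mem_iUnion.1 hv).imp' some fun _ => id
  have hdisjoint : Pairwise fun o o' : Option (Fin k) => Disjoint (o.elim B P) (o'.elim B P) := by
    rintro (_ | i) (_ | j) hne
    · exact (hne rfl).elim
    · exact h.disjoint_base j
    · exact (h.disjoint_base i).symm
    · exact h.disjoint_parts i j fun hij => hne (congrArg some hij)
  choose idx hidx using hcover
  have hfiber : ∀ o, o.elim B P = idx ⁻¹' {o} := fun o => by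
    ext v
    refine ⟨fun hv => by_contra fun hne => ?_, fun hv => ?_⟩
    · exact Set.disjoint_left.1 (hdisjoint hne) (hidx v) hv
    · exact (show idx v = o from hv) ▸ hidx v
  exact ⟨idx, hfiber none, funext fun i => hfiber (some i)⟩

theorem isDSeparated_of_boundary_subset {ι : Type*} {idx : V → ι}
    (h : ∀ i, boundary G (idx ⁻¹' {i}) ⊆
      Subtype.val '' (geA (piece G idx i) ∪ geC (piece G idx i))) : IsDSeparated G idx := by
  intro i x hx w hxw
  by_contra hw
  obtain ⟨y, hy, hyx⟩ := h i ⟨x.2, w, hw, hxw⟩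
  rw [Subtype.val_injective hyx] at hy
  exact hy.elim (fun hA => hA.1 hx) fun hC => hC (Or.inl hx)

theorem IsBABDecomposition.exists_isDSeparated (h : IsBABDecomposition G B P) :
    ∃ idx : V → Option (Fin k), B = idx ⁻¹' {none} ∧ P = (fun i => idx ⁻¹' {some i}) ∧
      IsDSeparated G idx := by
  obtain ⟨idx, rfl, rfl⟩ := h.exists_index
  refine ⟨idx, rfl, rfl, isDSeparated_of_boundary_subset fun o => ?_⟩
  obtain _ | i := o
  · exact h.boundary_base
  · exact (h.boundary_parts i).trans (Set.image_mono Set.subset_union_left)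

theorem partition_of_nucleus_subset (h : nucleus G ⊆ geD G) :
    nucleus G ∪ (geD G \ nucleus G) ∪ geA G ∪ geC G = Set.univ ∧
      [nucleus G, geD G \ nucleus G, geA G, geC G].Pairwise Disjoint := by
  have hDA : Disjoint (geD G) (geA G) := Set.disjoint_left.2 fun v hD hA => hA.1 hD
  have hDC : Disjoint (geD G) (geC G) := Set.disjoint_left.2 fun v hD hC => hC (Or.inl hD)
  have hAC : Disjoint (geA G) (geC G) := Set.disjoint_left.2 fun v hA hC => hC (Or.inr hA)
  constructor
  · rw [Set.union_sdiff_cancel h, geC, Set.union_compl_self]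
  · simp only [List.pairwise_cons, List.mem_cons, List.not_mem_nil, or_false, forall_eq_or_imp,
      forall_eq, List.Pairwise.nil, and_true, IsEmpty.forall_iff, implies_true]
    exact ⟨⟨Set.disjoint_sdiff_right, hDA.mono_left h, hDC.mono_left h⟩,
      ⟨hDA.mono_left Set.sdiff_subset, hDC.mono_left Set.sdiff_subset⟩, hAC⟩

variable [Finite V]

theorem IsBABDecomposition.hasAdaptedPairings (h : IsBABDecomposition G B P) :
    HasAdaptedPairings G := by
  obtain ⟨idx, rfl, rfl, hsep⟩ := h.exists_isDSeparated
  refine hsep.hasAdaptedPairings fun o => ?_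
  obtain _ | i := o
  · exact hasAdaptedPairings_of_isBipartite h.bipartite
  · obtain ⟨C, hC, hunique⟩ := h.almostBipartite i
    refine IsOddCycle.hasAdaptedPairings hC hunique ?_
    exact h.reach i C hC ▸ hC.verts_nonempty.mono (Set.subset_univ _)

theorem IsBABDecomposition.isBipartite_induce_geC (h : IsBABDecomposition G B P) :
    (G.induce (geC G)).IsBipartite := by
  obtain ⟨idx, rfl, rfl, hsep⟩ := h.exists_isDSeparated
  refine hsep.isBipartite_induce_geC (i := none) (fun o ho => ?_) h.bipartite
  obtain ⟨i, rfl⟩ := Option.ne_none_iff_exists'.1 ho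
  obtain ⟨C, hC, -⟩ := h.almostBipartite i
  exact IsOddCycle.geC_eq_empty hC (h.reach i C hC)

end Decomposition

end BAB

theorem mainTheorem11 {V : Type*} [Finite V] (G : SimpleGraph V) (hG : BAB.IsBABGraph G) :
    (BAB.closedNbhd G (BAB.diadem G) ∪ BAB.setY G = Set.univ ∧
      BAB.closedNbhd G (BAB.diadem G) ∩ BAB.setY G = ∅) ∧
    (BAB.nucleus G ∪ (BAB.geD G \ BAB.nucleus G) ∪ BAB.geA G ∪ BAB.geC G = Set.univ ∧
      [BAB.nucleus G, BAB.geD G \ BAB.nucleus G, BAB.geA G, BAB.geC G].Pairwise Disjoint) := by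
  obtain ⟨k, B, P, h⟩ := hG
  have hadapted := h.hasAdaptedPairings
  have hbipartite := h.isBipartite_induce_geC
  rw [hadapted.closedNbhd_diadem_eq hbipartite]
  exact ⟨⟨Set.compl_union_self _, Set.compl_inter_self _⟩,
    BAB.partition_of_nucleus_subset (hadapted.nucleus_subset hbipartite)⟩
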